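/- Let $n$ and $r_1,\dots,r_n$ be positive integers, $N=[r_1]\times\cdots\times[r_n]$, let $K$ be a field and $R=K[x_a : a\in N]$ the polynomial ring in variables indexed by $N$. Let $1\le t\le n$. For $a,b\in N$ let $d(a,b)$ be the number of components in which $a$ and $b$ differ, and for $i\in[n]$ let $s(i,a,b)\in N$ be the element obtained from $a$ by replacing its $i$-th component $a_i$ by $b_i$. Put $f_{i,a,b}=x_ax_b-x_{s(i,a,b)}x_{s(i,b,a)}$ and $$I^{\langle t\rangle}=(f_{i,a,b} : a,b\in N,\ d(a,b)=2,\ i\in[t]).$$ A subset $S\subseteq N$ is called $t$-switchable if $s(i,a,b)\in S$ for all $a,b\in S$ with $d(a,b)=2$ and all $i\in[t]$. Elements $a,b\in S$ are connected in $S$ if there are $a=a_0,a_1,\dots,a_k=b$ in $S$ (with $k\ge 0$) such that $d(a_{j-1},a_j)=1$ for $j=1,\dots,k$. For a $t$-switchable set $S$ let $$\tilde I^{\langle t\rangle}_S=(f_{i,a,b} : i\in[t],\ a,b \text{ connected in } S),\qquad P^{\langle t\rangle}_S=(x_a : a\in N\setminus S)+\tilde I^{\langle t\rangle}_S .$$ A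 $t$-switchable set $S$ is called maximal $t$-switchable if for every $t$-switchable $T\subseteq N$ properly containing $S$, the ideals $P^{\langle t\rangle}_S$ and $P^{\langle t\rangle}_T$ are incomparable, that is, neither contains the other. Then the set of prime ideals of $R$ minimal over $I^{\langle t\rangle}$ equals the set of ideals $P^{\langle t\rangle}_S$ as $S$ ranges over the maximal $t$-switchable subsets of $N$. -/

import Mathlib

noncomputable section

namespace CondIndep

/-- The index set `N = [r₁] × ⋯ × [rₙ]`, with all ranges starting at `0`. -/
abbrev Idx {n : ℕ} (r : Fin n → ℕ) : Type := ∀ i : Fin n, Fin (r i)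

variable {n : ℕ} {r : Fin n → ℕ}

/-- The switch `s(i, a, b)`: the index `a` with its `i`-th component replaced by that of `b`. -/
def switch (i : Fin n) (a b : Idx r) : Idx r := Function.update a i (b i)

/-- The `2 × 2` minor `f_{i,a,b} = x_a x_b - x_{s(i,a,b)} x_{s(i,b,a)}` of the generic
hypermatrix. -/
def minor (K : Type*) [Field K] (i : Fin n) (a b : Idx r) : MvPolynomial (Idx r) K :=
  MvPolynomial.X a * MvPolynomial.X b -
    MvPolynomial.X (switch i a b) * MvPolynomial.X (switch i b a)

/-- The conditional independence ideal `I^{⟨t⟩}`, generated by the `f_{i,a,b}` with `i` among the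
first `t` components and `a`, `b` differing in exactly two components. -/
def condIndepIdeal (K : Type*) [Field K] (r : Fin n → ℕ) (t : ℕ) :
    Ideal (MvPolynomial (Idx r) K) :=
  Ideal.span {f | ∃ (i : Fin n) (a b : Idx r),
    (i : ℕ) < t ∧ hammingDist a b = 2 ∧ f = minor K i a b}

/-- `S` is switchable in the first `t` components. -/
def IsSwitchable (t : ℕ) (S : Set (Idx r)) : Prop :=
  ∀ a ∈ S, ∀ b ∈ S, hammingDist a b = 2 → ∀ i : Fin n, (i : ℕ) < t → switch i a b ∈ S

/-- `a, b ∈ S` are joined by a path in `S` in which consecutive elements differ in exactly one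
component. -/
def ConnectedIn (S : Set (Idx r)) (a b : Idx r) : Prop :=
  a ∈ S ∧ b ∈ S ∧
    Relation.ReflTransGen (fun c d : Idx r => c ∈ S ∧ d ∈ S ∧ hammingDist c d = 1) a b

/-- The binomial part `Ĩ^{⟨t⟩}_S`. -/
def binomialIdeal (K : Type*) [Field K] (t : ℕ) (S : Set (Idx r)) :
    Ideal (MvPolynomial (Idx r) K) :=
  Ideal.span {f | ∃ (i : Fin n) (a b : Idx r),
    (i : ℕ) < t ∧ ConnectedIn S a b ∧ f = minor K i a b}

/-- The variable part `(x_a : a ∉ S)`. -/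
def varIdeal (K : Type*) [Field K] (S : Set (Idx r)) : Ideal (MvPolynomial (Idx r) K) :=
  Ideal.span {f | ∃ a : Idx r, a ∉ S ∧ f = MvPolynomial.X a}

/-- `P^{⟨t⟩}_S = (x_a : a ∉ S) + Ĩ^{⟨t⟩}_S`. -/
def primeIdeal (K : Type*) [Field K] (t : ℕ) (S : Set (Idx r)) :
    Ideal (MvPolynomial (Idx r) K) :=
  varIdeal K S + binomialIdeal K t S

/-- `S` is maximal `t`-switchable: it is `t`-switchable, and `P^{⟨t⟩}_S`, `P^{⟨t⟩}_T` are
incomparable for every `t`-switchable `T` properly containing `S`. -/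
def IsMaximalSwitchable (K : Type*) [Field K] (t : ℕ) (S : Set (Idx r)) : Prop :=
  IsSwitchable t S ∧ ∀ T : Set (Idx r), IsSwitchable t T → S ⊂ T →
    ¬ primeIdeal K t S ≤ primeIdeal K t T ∧ ¬ primeIdeal K t T ≤ primeIdeal K t S

end CondIndep

end

/-!
The minimal primes come from two facts.

Every prime `Q` over `condIndepIdeal` contains `primeIdeal K t S` for the switchable set `S` of
indices `a` with `x_a ∉ Q` (`primeIdeal_le_of_isPrime`). Fix a component `i < t`. Along a path
in `S`, the set of values that component `i` may take inside `S` does not change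
(`IsSwitchable.update_mem`), and the vector of variables indexed by these values only changes, in
the domain of residues modulo `Q`, by proportionality (`update_minor_mem_of_connectedIn`), since
the variables involved are nonzero and may be cancelled. Proportionality is the vanishing of the
minors attached to connected pairs.

Conversely `primeIdeal K t S` is prime for every switchable `S` (`primeIdeal_isPrime`), as it is
the kernel of a monomial map into a polynomial ring. The map sends `x_a` to a product of variables
recording, each together with the connected component of `a` in `S`, the components `a_i` with
`i < t` one by one, and the remaining components jointly; it kills `x_a` for `a ∉ S`. The connected
components of `S` are closed under all switches in components below `t`, so two monomials with the
same image are linked by switches (`monomial_sub_monomial_mem`). Hence the quotient map factors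
linearly through the monomial map, which bounds the kernel (`ker_parametrization_le`).

As `primeIdeal K t S` contains `x_a` exactly for `a ∉ S`, inclusions between these ideals reverse
inclusions between the sets. The incomparability in the definition of a maximal switchable set `S`
therefore only says that no `primeIdeal K t T` is strictly smaller than `primeIdeal K t S`.
-/

namespace CondIndep

open MvPolynomial

variable {n : ℕ} {r : Fin n → ℕ} {t : ℕ} {S : Set (Idx r)}

/-! ### Switches and connected components -/

lemma switch_switch (i : Fin n) (a b : Idx r) : switch i (switch i a b) (switch i b a) = a := by
  simp [switch]

lemma update_eq_update_of_hammingDist_eq_one {c d : Idx r} (h : hammingDist c d = 1) {i : Fin n}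
    (hi : c i ≠ d i) (u : Fin (r i)) : Function.update c i u = Function.update d i u := by
  obtain ⟨k, hk⟩ := Finset.card_eq_one.mp h
  have key : ∀ j, c j ≠ d j → j = k := fun j hj => by
    have : j ∈ ({k} : Finset (Fin n)) := hk ▸ by simpa using hj
    simpa using this
  ext1 j
  rcases eq_or_ne j i with rfl | hj
  · simp
  · rw [Function.update_of_ne hj, Function.update_of_ne hj]
    by_contra hne
    exact hj ((key j hne).trans (key i hi).symm)

lemma hammingDist_update_update {c d : Idx r} (h : hammingDist c d = 1) {i : Fin n}
    (hi : c i = d i) {u v : Fin (r i)} (huv : u ≠ v) :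
    hammingDist (Function.update c i u) (Function.update d i v) = 2 := by
  have : (Finset.univ.filter fun j => Function.update c i u j ≠ Function.update d i v j) =
      insert i (Finset.univ.filter fun j => c j ≠ d j) := by
    ext j
    rcases eq_or_ne j i with rfl | hj
    · simpa using huv
    · simp [hj]
  unfold hammingDist at h ⊢
  rw [this, Finset.card_insert_of_notMem (by simpa using hi), h]

lemma hammingDist_switch_le (i : Fin n) (a b : Idx r) : hammingDist a (switch i a b) ≤ 1 := by
  refine (Finset.card_le_card (t := {i}) fun j hj => ?_).trans (by simp)
  by_contra hne
  have hj := (Finset.mem_filter.mp hj).2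
  simp_all [switch]

lemma hammingDist_switch_switch (i : Fin n) (a b : Idx r) :
    hammingDist (switch i a b) (switch i b a) = hammingDist a b := by
  unfold hammingDist
  congr 1
  ext j
  rw [Finset.mem_filter, Finset.mem_filter]
  rcases eq_or_ne j i with rfl | hj
  · simp [switch, eq_comm]
  · simp [switch, hj]

lemma hammingDist_switch_lt {i : Fin n} {a b c : Idx r} (hb : b i ≠ a i) (hc : c i = a i) :
    hammingDist (switch i b c) a < hammingDist b a := by
  refine Finset.card_lt_card ⟨fun j hj => ?_, fun hle => ?_⟩
  · have hj := (Finset.mem_filter.mp hj).2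
    rcases eq_or_ne j i with rfl | hne
    · simpa using hb
    · simpa [switch, hne] using hj
  · have hi := (Finset.mem_filter.mp (hle (Finset.mem_filter.mpr ⟨Finset.mem_univ i, hb⟩))).2
    simp [switch, hc] at hi

lemma ConnectedIn.refl {a : Idx r} (ha : a ∈ S) : ConnectedIn S a a := ⟨ha, ha, .refl⟩

lemma ConnectedIn.symm {a b : Idx r} (h : ConnectedIn S a b) : ConnectedIn S b a := by
  refine ⟨h.2.1, h.1, ?_⟩
  refine @Std.Symm.symm _ _ (@Relation.ReflTransGen.stdSymm _ _ ?_) _ _ h.2.2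
  exact ⟨fun c d hcd => ⟨hcd.2.1, hcd.1, by rw [hammingDist_comm]; exact hcd.2.2⟩⟩

lemma ConnectedIn.trans {a b c : Idx r} (h : ConnectedIn S a b) (h' : ConnectedIn S b c) :
    ConnectedIn S a c := ⟨h.1, h'.2.1, h.2.2.trans h'.2.2⟩

lemma ConnectedIn.of_hammingDist_le_one {a b : Idx r} (ha : a ∈ S) (hb : b ∈ S)
    (h : hammingDist a b ≤ 1) : ConnectedIn S a b := by
  refine ⟨ha, hb, ?_⟩
  rcases Nat.le_one_iff_eq_zero_or_eq_one.mp h with h | h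
  · rw [hammingDist_eq_zero.mp h]
  · exact .single ⟨ha, hb, h⟩

/-- The set of values that may be put into component `i` without leaving `S` is constant on
connected components, when `i` is one of the switchable components. -/
lemma IsSwitchable.update_mem (hS : IsSwitchable t S) {i : Fin n} (hi : (i : ℕ) < t)
    {a b : Idx r} (h : ConnectedIn S a b) {u : Fin (r i)} (hu : Function.update a i u ∈ S) :
    Function.update b i u ∈ S := by
  obtain ⟨-, -, h⟩ := h
  induction h with
  | refl => exact hu
  | @tail c d _ hcd ih =>
    obtain ⟨_, hd, h1⟩ := hcd
    by_cases hne : c i = d i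
    · by_cases hud : u = d i
      · rwa [hud, Function.update_eq_self]
      · have h2 := hammingDist_update_update h1 hne hud
        rw [Function.update_eq_self, hammingDist_comm] at h2
        simpa [switch] using hS _ hd _ ih h2 i hi
    · rwa [← update_eq_update_of_hammingDist_eq_one h1 hne]

lemma IsSwitchable.connectedIn_switch (hS : IsSwitchable t S) {i : Fin n} (hi : (i : ℕ) < t)
    {a b : Idx r} (h : ConnectedIn S a b) : ConnectedIn S a (switch i a b) := by
  refine .of_hammingDist_le_one h.1 ?_ (hammingDist_switch_le i a b)
  exact hS.update_mem hi h.symm (by simpa using h.2.1)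

lemma IsSwitchable.switch_mem_iff (hS : IsSwitchable t S) {i : Fin n} (hi : (i : ℕ) < t)
    {a b : Idx r} (h : hammingDist a b = 2) :
    (switch i a b ∈ S ∧ switch i b a ∈ S) ↔ (a ∈ S ∧ b ∈ S) := by
  have hba : hammingDist b a = 2 := by rwa [hammingDist_comm]
  refine ⟨fun ⟨h1, h2⟩ => ⟨?_, ?_⟩, fun ⟨h1, h2⟩ => ⟨hS a h1 b h2 h i hi, hS b h2 a h1 hba i hi⟩⟩
  · simpa [switch_switch] using hS _ h1 _ h2 (by rwa [hammingDist_switch_switch]) i hi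
  · simpa [switch_switch] using hS _ h2 _ h1 (by rwa [hammingDist_switch_switch]) i hi

/-! ### The ideals `primeIdeal` and the conditional independence ideal -/

variable (K : Type*) [Field K]

lemma X_mem_primeIdeal {a : Idx r} (ha : a ∉ S) : X a ∈ primeIdeal K t S :=
  Ideal.mem_sup_left (Ideal.subset_span ⟨a, ha, rfl⟩)

lemma minor_mem_primeIdeal {i : Fin n} (hi : (i : ℕ) < t) {a b : Idx r}
    (h : ConnectedIn S a b) : minor K i a b ∈ primeIdeal K t S :=
  Ideal.mem_sup_right (Ideal.subset_span ⟨i, a, b, hi, h, rfl⟩)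

lemma X_mul_X_mem_primeIdeal {a b : Idx r} (h : ¬ (a ∈ S ∧ b ∈ S)) :
    X a * X b ∈ primeIdeal K t S := by
  by_cases ha : a ∈ S
  · exact Ideal.mul_mem_left _ _ (X_mem_primeIdeal K fun hb => h ⟨ha, hb⟩)
  · exact Ideal.mul_mem_right _ _ (X_mem_primeIdeal K ha)

lemma primeIdeal_le_iff {P : Ideal (MvPolynomial (Idx r) K)} :
    primeIdeal K t S ≤ P ↔ (∀ a ∉ S, X a ∈ P) ∧
      ∀ i : Fin n, (i : ℕ) < t → ∀ a b, ConnectedIn S a b → minor K i a b ∈ P := by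
  rw [primeIdeal, Submodule.add_eq_sup, sup_le_iff, varIdeal, binomialIdeal, Ideal.span_le,
    Ideal.span_le]
  refine and_congr ⟨fun h a ha => h ⟨a, ha, rfl⟩, ?_⟩
    ⟨fun h i hi a b hab => h ⟨i, a, b, hi, hab, rfl⟩, ?_⟩
  · rintro h _ ⟨a, ha, rfl⟩
    exact h a ha
  · rintro h _ ⟨i, a, b, hi, hab, rfl⟩
    exact h i hi a b hab

lemma condIndepIdeal_le_primeIdeal (hS : IsSwitchable t S) :
    condIndepIdeal K r t ≤ primeIdeal K t S := by
  refine Ideal.span_le.mpr ?_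
  rintro _ ⟨i, a, b, hi, hab, rfl⟩
  by_cases hmem : a ∈ S ∧ b ∈ S
  · by_cases hne : a i = b i
    · have : minor K i a b = 0 := by
        rw [minor, switch, switch, ← hne, Function.update_eq_self, hne, Function.update_eq_self,
          sub_self]
      simp [this]
    · refine minor_mem_primeIdeal K hi ?_
      have hs : switch i a b ∈ S := hS a hmem.1 b hmem.2 hab i hi
      refine (ConnectedIn.of_hammingDist_le_one hmem.1 hs (hammingDist_switch_le i a b)).trans
        (.of_hammingDist_le_one hs hmem.2 ?_)
      have := hammingDist_switch_lt (i := i) (a := b) (b := a) (c := b) hne rfl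
      omega
  · exact Ideal.sub_mem _ (X_mul_X_mem_primeIdeal K hmem)
      (X_mul_X_mem_primeIdeal K (mt (hS.switch_mem_iff hi hab).mp hmem))

variable {K}

lemma isSwitchable_setOf_X_notMem {Q : Ideal (MvPolynomial (Idx r) K)} (hQ : Q.IsPrime)
    (hle : condIndepIdeal K r t ≤ Q) : IsSwitchable t {a : Idx r | X a ∉ Q} := by
  intro a ha b hb hab i hi hs
  have hf : minor K i a b ∈ Q := hle (Ideal.subset_span ⟨i, a, b, hi, hab, rfl⟩)
  have hab' : (X a * X b : MvPolynomial (Idx r) K) ∈ Q := by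
    simpa [minor] using Ideal.add_mem _ hf (Ideal.mul_mem_right (X (switch i b a)) _ hs)
  exact (hQ.mem_or_mem hab').elim ha hb

/-- Modulo a prime `Q` over `condIndepIdeal`, the fibres in direction `i` over two connected
indices carry proportional vectors of variables. -/
lemma update_minor_mem_of_connectedIn {Q : Ideal (MvPolynomial (Idx r) K)} (hQ : Q.IsPrime)
    (hle : condIndepIdeal K r t ≤ Q) {i : Fin n} (hi : (i : ℕ) < t) {a b : Idx r}
    (h : ConnectedIn {a : Idx r | X a ∉ Q} a b) {u v : Fin (r i)}
    (hu : X (R := K) (Function.update a i u) ∉ Q) (hv : X (R := K) (Function.update a i v) ∉ Q) :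
    (X (Function.update a i u) * X (Function.update b i v) -
      X (Function.update a i v) * X (Function.update b i u) : MvPolynomial (Idx r) K) ∈ Q := by
  have hS := isSwitchable_setOf_X_notMem hQ hle
  obtain ⟨ha, -, h⟩ := h
  induction h with
  | refl => rw [mul_comm, sub_self]; exact Q.zero_mem
  | @tail c d hac hcd ih =>
    obtain ⟨hc, hd, h1⟩ := hcd
    by_cases hne : c i = d i
    · by_cases huv : u = v
      · subst huv; rw [sub_self]; exact Q.zero_mem
      have hcu := hS.update_mem hi ⟨ha, hc, hac⟩ hu
      have hf : minor K i (Function.update c i u) (Function.update d i v) ∈ Q :=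
        hle (Ideal.subset_span ⟨i, _, _, hi, hammingDist_update_update h1 hne huv, rfl⟩)
      simp only [minor, switch, Function.update_self, Function.update_idem] at hf
      -- Transitivity of proportionality: the entry at `update c i u` may be cancelled.
      refine (hQ.mem_or_mem (x := X (Function.update c i u)) ?_).resolve_left hcu
      have e1 := Q.mul_mem_left (X (Function.update a i u)) hf
      have e2 := Q.mul_mem_left (X (Function.update d i u)) ih
      convert Q.add_mem e1 e2 using 1
      ring
    · rwa [← update_eq_update_of_hammingDist_eq_one h1 hne,
        ← update_eq_update_of_hammingDist_eq_one h1 hne]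

lemma primeIdeal_le_of_isPrime {Q : Ideal (MvPolynomial (Idx r) K)} (hQ : Q.IsPrime)
    (hle : condIndepIdeal K r t ≤ Q) : primeIdeal K t {a : Idx r | X a ∉ Q} ≤ Q := by
  refine (primeIdeal_le_iff K).mpr ⟨fun a ha => not_not.mp ha, fun i hi a b hab => ?_⟩
  have hs := ((isSwitchable_setOf_X_notMem hQ hle).connectedIn_switch hi hab).2.1
  have ha : X (R := K) (Function.update a i (a i)) ∉ Q := by simpa using hab.1
  simpa [minor, switch] using update_minor_mem_of_connectedIn hQ hle hi hab ha hs

/-! ### The monomial parametrization -/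

/-- The features of an index recorded by the parametrization: `none` stands for the connected
component together with the components of index at least `t`; `some i` with `i < t` stands for the
connected component together with component `i`. For `t ≤ i` the feature `some i` is the same as
`none`. -/
def SameFeature (t : ℕ) : Option (Fin n) → Idx r → Idx r → Prop
  | none, a, b => ∀ j : Fin n, t ≤ (j : ℕ) → a j = b j
  | some i, a, b => if (i : ℕ) < t then a i = b i else ∀ j : Fin n, t ≤ (j : ℕ) → a j = b j

/-- The class of `a` in `S` for the feature `o`; it serves as the value of that feature. -/
def featureClass (t : ℕ) (S : Set (Idx r)) (o : Option (Fin n)) (a : Idx r) : Set (Idx r) :=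
  {b | ConnectedIn S a b ∧ SameFeature t o a b}

/-- The exponent of the monomial parametrizing the variable `x_a`: one variable for each feature
of `a`. -/
noncomputable def featureExponent (t : ℕ) (S : Set (Idx r)) (a : Idx r) :
    Option (Fin n) × Set (Idx r) →₀ ℕ :=
  ∑ o, Finsupp.single (o, featureClass t S o a) 1

/-- The exponent of the image of a monomial under the parametrization. -/
noncomputable def weight (t : ℕ) (S : Set (Idx r)) :
    (Idx r →₀ ℕ) →ₗ[ℕ] (Option (Fin n) × Set (Idx r) →₀ ℕ) :=
  Finsupp.linearCombination ℕ (featureExponent t S)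

variable (K) in
/-- The monomial parametrization, sending `x_a` to the product of the features of `a` if `a ∈ S`,
and to `0` otherwise. -/
noncomputable def parametrization (t : ℕ) (S : Set (Idx r)) :
    MvPolynomial (Idx r) K →ₐ[K] MvPolynomial (Option (Fin n) × Set (Idx r)) K :=
  open Classical in
  aeval fun a => if a ∈ S then monomial (featureExponent t S a) 1 else 0

lemma SameFeature.refl (o : Option (Fin n)) (a : Idx r) : SameFeature t o a a := by
  rcases o with _ | i
  · exact fun _ _ => rfl
  · simp [SameFeature]

lemma SameFeature.symm {o : Option (Fin n)} {a b : Idx r} (h : SameFeature t o a b) :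
    SameFeature t o b a := by
  rcases o with _ | i
  · exact fun j hj => (h j hj).symm
  · simp only [SameFeature] at h ⊢
    split_ifs at h ⊢
    · exact h.symm
    · exact fun j hj => (h j hj).symm

lemma SameFeature.trans {o : Option (Fin n)} {a b c : Idx r} (h : SameFeature t o a b)
    (h' : SameFeature t o b c) : SameFeature t o a c := by
  rcases o with _ | i
  · exact fun j hj => (h j hj).trans (h' j hj)
  · simp only [SameFeature] at h h' ⊢
    split_ifs at h h' ⊢
    · exact h.trans h'
    · exact fun j hj => (h j hj).trans (h' j hj)

lemma featureClass_eq_iff {o : Option (Fin n)} {a b : Idx r} (hb : b ∈ S) :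
    featureClass t S o a = featureClass t S o b ↔ ConnectedIn S a b ∧ SameFeature t o a b := by
  refine ⟨fun h => ?_, fun ⟨h, h'⟩ => ?_⟩
  · have : b ∈ featureClass t S o b := ⟨.refl hb, .refl o b⟩
    rwa [← h] at this
  · ext c
    exact ⟨fun hc => ⟨h.symm.trans hc.1, h'.symm.trans hc.2⟩,
      fun hc => ⟨h.trans hc.1, h'.trans hc.2⟩⟩

lemma featureExponent_apply_ne_zero_iff {a : Idx r} {o : Option (Fin n)} {C : Set (Idx r)} :
    featureExponent t S a (o, C) ≠ 0 ↔ featureClass t S o a = C := by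
  classical
  rw [featureExponent, Finsupp.finsetSum_apply, Finset.sum_eq_single o]
  · simp [Finsupp.single_apply]
  · intro o' _ ho'
    simp [ho'.symm]
  · simp

lemma featureExponent_add_switch (hS : IsSwitchable t S) {i : Fin n} (hi : (i : ℕ) < t)
    {a b : Idx r} (h : ConnectedIn S a b) :
    featureExponent t S (switch i a b) + featureExponent t S (switch i b a) =
      featureExponent t S a + featureExponent t S b := by
  have ha := (hS.connectedIn_switch hi h).symm
  have hb := (hS.connectedIn_switch hi h.symm).symm
  unfold featureExponent
  rw [← Finset.sum_add_distrib, ← Finset.sum_add_distrib]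
  refine Finset.sum_congr rfl fun o _ => ?_
  by_cases ho : o = some i
  · -- The feature `some i` is exchanged by the switch, all others are kept.
    subst ho
    rw [(featureClass_eq_iff h.2.1).mpr ⟨ha.trans h, by simp [SameFeature, hi, switch]⟩,
      (featureClass_eq_iff h.1).mpr ⟨hb.trans h.symm, by simp [SameFeature, hi, switch]⟩, add_comm]
  · have keep : ∀ c d : Idx r, SameFeature t o (switch i c d) c := by
      intro c d
      have htail : ∀ j : Fin n, t ≤ (j : ℕ) → switch i c d j = c j := fun j hj =>
        Function.update_of_ne (by rintro rfl; omega) _ _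
      rcases o with _ | k
      · exact htail
      · simp only [SameFeature]
        split_ifs
        · exact Function.update_of_ne (by rintro rfl; exact ho rfl) _ _
        · exact htail
    rw [(featureClass_eq_iff h.1).mpr ⟨ha, keep a b⟩,
      (featureClass_eq_iff h.2.1).mpr ⟨hb, keep b a⟩]

lemma weight_single (a : Idx r) : weight t S (Finsupp.single a 1) = featureExponent t S a := by
  simp [weight]

lemma exists_mem_support_of_weight_apply_ne_zero {m : Idx r →₀ ℕ} {o : Option (Fin n)}
    {C : Set (Idx r)} (h : weight t S m (o, C) ≠ 0) :
    ∃ b ∈ m.support, featureClass t S o b = C := by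
  rw [weight, Finsupp.linearCombination_apply, Finsupp.sum, Finsupp.finsetSum_apply] at h
  obtain ⟨b, hb, hne⟩ := Finset.exists_ne_zero_of_sum_ne_zero h
  refine ⟨b, hb, featureExponent_apply_ne_zero_iff.mp fun h0 => hne ?_⟩
  simp [h0]

/-- Two monomials of equal weight involve the same values of every feature. -/
lemma exists_mem_support_sameFeature {m : Idx r →₀ ℕ} (hm : ∀ a ∈ m.support, a ∈ S) {a : Idx r}
    {w : Option (Fin n) × Set (Idx r) →₀ ℕ} (h : weight t S m = featureExponent t S a + w)
    (o : Option (Fin n)) :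
    ∃ b ∈ m.support, ConnectedIn S a b ∧ SameFeature t o a b := by
  have h1 : weight t S m (o, featureClass t S o a) ≠ 0 := by
    have := (featureExponent_apply_ne_zero_iff (t := t) (S := S) (a := a) (o := o)).mpr rfl
    rw [h, Finsupp.add_apply]
    omega
  obtain ⟨b, hb, hab⟩ := exists_mem_support_of_weight_apply_ne_zero h1
  exact ⟨b, hb, (featureClass_eq_iff (hm b hb)).mp hab.symm⟩

lemma exists_eq_single_add {m : Idx r →₀ ℕ} {b : Idx r} (hb : b ∈ m.support) :
    ∃ m', m = Finsupp.single b 1 + m' :=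
  ⟨m - Finsupp.single b 1, (add_tsub_cancel_of_le (by
    rw [Finsupp.single_le_iff]
    exact Nat.one_le_iff_ne_zero.mpr (Finsupp.mem_support_iff.mp hb))).symm⟩

lemma mem_support_single_add {m : Idx r →₀ ℕ} {a b : Idx r} :
    b ∈ (Finsupp.single a 1 + m).support ↔ b = a ∨ b ∈ m.support := by
  classical
  rcases eq_or_ne b a with rfl | h
  · simp
  · simp [h]

/-- A monomial in the variables of `S` whose weight dominates that of `x_a` is congruent, modulo
`primeIdeal`, to a monomial divisible by `x_a`: start with a factor `x_b` having the same `none`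
feature as `x_a`, and correct the components of `b` by switches. -/
lemma exists_monomial_single_add_sub_mem (hS : IsSwitchable t S) {a : Idx r}
    {w : Option (Fin n) × Set (Idx r) →₀ ℕ} (k : ℕ) :
    ∀ (b : Idx r) (m : Idx r →₀ ℕ), hammingDist b a = k → ConnectedIn S a b →
      SameFeature t none a b → (∀ c ∈ m.support, c ∈ S) →
      weight t S (Finsupp.single b 1 + m) = featureExponent t S a + w →
      ∃ m' : Idx r →₀ ℕ, (∀ c ∈ m'.support, c ∈ S) ∧ weight t S m' = w ∧
        (monomial (Finsupp.single b 1 + m) 1 - monomial (Finsupp.single a 1 + m') 1 :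
          MvPolynomial (Idx r) K) ∈ primeIdeal K t S := by
  induction k using Nat.strong_induction_on with
  | _ k ih =>
  intro b m hk hab htail hm hw
  by_cases hba : b = a
  · subst hba
    refine ⟨m, hm, ?_, by simp⟩
    rw [map_add, weight_single] at hw
    exact add_left_cancel hw
  obtain ⟨i, hne⟩ := Function.ne_iff.mp hba
  have hi : (i : ℕ) < t := by
    by_contra hi
    exact hne (htail i (not_lt.mp hi)).symm
  have hmem : ∀ c ∈ (Finsupp.single b 1 + m).support, c ∈ S := fun c hc => by
    rcases mem_support_single_add.mp hc with rfl | hc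
    exacts [hab.2.1, hm c hc]
  obtain ⟨c, hc, hac, hfc⟩ := exists_mem_support_sameFeature hmem hw (some i)
  simp only [SameFeature, hi, if_true] at hfc
  rcases mem_support_single_add.mp hc with rfl | hc
  · exact absurd hfc.symm hne
  obtain ⟨m₀, rfl⟩ := exists_eq_single_add hc
  have hbc := hab.symm.trans hac
  have hb' := hS.connectedIn_switch hi hbc
  have hc' := hS.connectedIn_switch hi hbc.symm
  obtain ⟨m', hm', hwt, hcong⟩ := ih _ (hk ▸ hammingDist_switch_lt hne hfc.symm)
    (switch i b c) (Finsupp.single (switch i c b) 1 + m₀) rfl (hab.trans hb')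
    (fun j hj => (htail j hj).trans
      (Function.update_of_ne (by rintro rfl; omega) _ _).symm)
    (fun e he => by
      rcases mem_support_single_add.mp he with rfl | he
      exacts [hc'.2.1, hm e (mem_support_single_add.mpr (.inr he))])
    (by
      rw [← hw]
      simp only [map_add, weight_single]
      rw [← add_assoc, featureExponent_add_switch hS hi hbc, add_assoc])
  refine ⟨m', hm', hwt, ?_⟩
  have hf := Ideal.mul_mem_right (monomial m₀ 1) _ (minor_mem_primeIdeal K hi hbc)
  convert Ideal.add_mem _ hf hcong using 1
  simp only [minor, X, sub_mul, monomial_mul, mul_one, add_assoc]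
  ring

/-- Monomials in the variables of `S` with equal weight are congruent modulo `primeIdeal`. -/
lemma monomial_sub_monomial_mem (hS : IsSwitchable t S) (m : Idx r →₀ ℕ) :
    ∀ m' : Idx r →₀ ℕ, (∀ a ∈ m.support, a ∈ S) → (∀ a ∈ m'.support, a ∈ S) →
      weight t S m = weight t S m' →
      (monomial m 1 - monomial m' 1 : MvPolynomial (Idx r) K) ∈ primeIdeal K t S := by
  induction hk : m.degree generalizing m with
  | zero =>
    intro m' _ _ hw
    rw [Finsupp.degree_eq_zero_iff] at hk
    subst hk
    have : m' = 0 := by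
      by_contra hne
      obtain ⟨a, ha⟩ := Finsupp.support_nonempty_iff.mpr hne
      obtain ⟨m₀, rfl⟩ := exists_eq_single_add ha
      have h0 := congrArg (fun f => f (none, featureClass t S none a)) hw
      have := (featureExponent_apply_ne_zero_iff (t := t) (S := S) (a := a) (o := none)).mpr rfl
      simp only [map_zero, map_add, weight_single, Finsupp.add_apply, Finsupp.coe_zero,
        Pi.zero_apply] at h0
      omega
    simp [this]
  | succ k ih =>
    intro m' hm hm' hw
    have hne : m ≠ 0 := by
      rintro rfl
      simp at hk
    obtain ⟨a, ha⟩ := Finsupp.support_nonempty_iff.mpr hne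
    obtain ⟨m₁, rfl⟩ := exists_eq_single_add ha
    rw [map_add, weight_single] at hw
    obtain ⟨b, hb, hab, hfb⟩ := exists_mem_support_sameFeature hm' hw.symm none
    obtain ⟨m₂, rfl⟩ := exists_eq_single_add hb
    obtain ⟨m₃, hm₃, hw₃, hcong⟩ :=
      exists_monomial_single_add_sub_mem (K := K) hS _ b m₂ rfl hab hfb
        (fun c hc => hm' c (mem_support_single_add.mpr (.inr hc))) hw.symm
    have hdeg : m₁.degree = k := by
      rw [map_add, Finsupp.degree_single] at hk
      omega
    have h1 := ih m₁ hdeg m₃ (fun c hc => hm c (mem_support_single_add.mpr (.inr hc))) hm₃ hw₃.symm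
    have h2 := Ideal.sub_mem _ (Ideal.mul_mem_left _ (X a) h1) hcong
    convert h2 using 1
    simp only [X, mul_sub, monomial_mul, mul_one]
    ring

lemma monomial_mem_primeIdeal {m : Idx r →₀ ℕ} {a : Idx r} (ha : a ∈ m.support) (haS : a ∉ S) :
    (monomial m 1 : MvPolynomial (Idx r) K) ∈ primeIdeal K t S := by
  obtain ⟨m', rfl⟩ := exists_eq_single_add ha
  have := Ideal.mul_mem_right (monomial m' 1) _ (X_mem_primeIdeal (t := t) K haS)
  simpa [X, monomial_mul] using this

lemma parametrization_X_of_mem {a : Idx r} (ha : a ∈ S) :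
    parametrization K t S (X a) = monomial (featureExponent t S a) 1 := by
  simp [parametrization, ha]

lemma parametrization_X_of_notMem {a : Idx r} (ha : a ∉ S) :
    parametrization K t S (X a) = 0 := by
  simp [parametrization, ha]

lemma parametrization_monomial {m : Idx r →₀ ℕ} (hm : ∀ a ∈ m.support, a ∈ S) :
    parametrization K t S (monomial m 1) = monomial (weight t S m) 1 := by
  rw [monomial_eq, C_1, one_mul, Finsupp.prod, map_prod, weight, Finsupp.linearCombination_apply,
    Finsupp.sum, monomial_sum_one]
  refine Finset.prod_congr rfl fun a ha => ?_
  rw [map_pow, parametrization_X_of_mem (hm a ha), monomial_pow, one_pow]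

lemma primeIdeal_le_ker (hS : IsSwitchable t S) :
    primeIdeal K t S ≤ RingHom.ker (parametrization K t S) := by
  refine (primeIdeal_le_iff K).mpr ⟨fun a ha => parametrization_X_of_notMem ha,
    fun i hi a b hab => ?_⟩
  rw [RingHom.mem_ker, minor, map_sub, map_mul, map_mul, parametrization_X_of_mem hab.1,
    parametrization_X_of_mem hab.2.1,
    parametrization_X_of_mem (hS.connectedIn_switch hi hab).2.1,
    parametrization_X_of_mem (hS.connectedIn_switch hi hab.symm).2.1, monomial_mul, monomial_mul,
    featureExponent_add_switch hS hi hab, sub_self]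

/-- The quotient map by `primeIdeal` factors linearly through the parametrization, because the
class of a monomial in the variables of `S` depends on its weight only. -/
lemma ker_parametrization_le (hS : IsSwitchable t S) :
    RingHom.ker (parametrization K t S) ≤ primeIdeal K t S := by
  classical
  let π := Ideal.Quotient.mkₐ K (primeIdeal K t S)
  let ψ : MvPolynomial (Option (Fin n) × Set (Idx r)) K →ₗ[K]
      MvPolynomial (Idx r) K ⧸ primeIdeal K t S :=
    (basisMonomials _ K).constr K fun w =>
      if h : ∃ m : Idx r →₀ ℕ, (∀ a ∈ m.support, a ∈ S) ∧ weight t S m = w then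
        π (monomial h.choose 1) else 0
  have hψ : ψ ∘ₗ (parametrization K t S).toLinearMap = π.toLinearMap := by
    refine (basisMonomials _ K).ext fun m => ?_
    simp only [coe_basisMonomials, LinearMap.comp_apply, AlgHom.toLinearMap_apply]
    by_cases hm : ∀ a ∈ m.support, a ∈ S
    · have h : ∃ m' : Idx r →₀ ℕ, (∀ a ∈ m'.support, a ∈ S) ∧ weight t S m' = weight t S m :=
        ⟨m, hm, rfl⟩
      have hb : ψ (monomial (weight t S m) 1) = π (monomial h.choose 1) := by
        have := (basisMonomials (Option (Fin n) × Set (Idx r)) K).constr_basis K (fun w =>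
          if h : ∃ m : Idx r →₀ ℕ, (∀ a ∈ m.support, a ∈ S) ∧ weight t S m = w then
            π (monomial h.choose 1) else 0) (weight t S m)
        rwa [dif_pos h, coe_basisMonomials] at this
      rw [parametrization_monomial hm, hb]
      exact Ideal.Quotient.eq.mpr
        (monomial_sub_monomial_mem hS _ _ h.choose_spec.1 hm h.choose_spec.2)
    · push Not at hm
      obtain ⟨a, ha, haS⟩ := hm
      have hmem : (monomial m 1 : MvPolynomial (Idx r) K) ∈ primeIdeal K t S :=
        monomial_mem_primeIdeal ha haS
      rw [RingHom.mem_ker.mp (primeIdeal_le_ker hS hmem), map_zero]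
      exact (Ideal.Quotient.eq_zero_iff_mem.mpr hmem).symm
  intro f hf
  have h := LinearMap.congr_fun hψ f
  rw [LinearMap.comp_apply, AlgHom.toLinearMap_apply, RingHom.mem_ker.mp hf, map_zero] at h
  exact Ideal.Quotient.eq_zero_iff_mem.mp h.symm

variable (K) in
lemma primeIdeal_isPrime (hS : IsSwitchable t S) : (primeIdeal K t S).IsPrime := by
  rw [le_antisymm (primeIdeal_le_ker hS) (ker_parametrization_le hS)]
  exact RingHom.ker_isPrime _

lemma X_mem_primeIdeal_iff (hS : IsSwitchable t S) {a : Idx r} :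
    X a ∈ primeIdeal K t S ↔ a ∉ S := by
  refine ⟨fun h ha => ?_, X_mem_primeIdeal K⟩
  have := RingHom.mem_ker.mp (primeIdeal_le_ker hS h)
  rw [parametrization_X_of_mem ha, monomial_eq_zero] at this
  exact one_ne_zero this

lemma subset_of_primeIdeal_le {T : Set (Idx r)} (hS : IsSwitchable t S)
    (h : primeIdeal K t T ≤ primeIdeal K t S) : S ⊆ T := by
  intro a ha
  by_contra haT
  exact (X_mem_primeIdeal_iff hS).mp (h (X_mem_primeIdeal K haT)) ha

end CondIndep

/-! ### Minimal primes -/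

open CondIndep in
theorem mainTheorem1 {K : Type*} [Field K] {n : ℕ} (r : Fin n → ℕ) (hr : ∀ i, 0 < r i)
    (t : ℕ) (ht : 1 ≤ t) (htn : t ≤ n) :
    (CondIndep.condIndepIdeal K r t).minimalPrimes =
      {P : Ideal (MvPolynomial (CondIndep.Idx r) K) |
        ∃ S : Set (CondIndep.Idx r),
          CondIndep.IsMaximalSwitchable K t S ∧ P = CondIndep.primeIdeal K t S} := by
  ext P
  constructor
  · rintro ⟨⟨hP, hIP⟩, hmin⟩
    have hS := isSwitchable_setOf_X_notMem hP hIP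
    have hle := primeIdeal_le_of_isPrime hP hIP
    have hP_le : ∀ T, IsSwitchable t T → primeIdeal K t T ≤ P → P ≤ primeIdeal K t T :=
      fun T hT h => hmin ⟨primeIdeal_isPrime K hT, condIndepIdeal_le_primeIdeal K hT⟩ h
    have heq := le_antisymm (hP_le _ hS hle) hle
    refine ⟨_, ⟨hS, fun T hT hST => ⟨fun h => ?_, fun h => ?_⟩⟩, heq⟩
    · exact hST.not_subset (subset_of_primeIdeal_le hT h)
    · exact hST.not_subset (subset_of_primeIdeal_le hT (hle.trans (hP_le T hT (h.trans hle))))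
  · rintro ⟨S, ⟨hS, hmax⟩, rfl⟩
    refine ⟨⟨primeIdeal_isPrime K hS, condIndepIdeal_le_primeIdeal K hS⟩, ?_⟩
    rintro Q ⟨hQ, hIQ⟩ hQS
    have hT := isSwitchable_setOf_X_notMem hQ hIQ
    have hTQ := primeIdeal_le_of_isPrime hQ hIQ
    rcases (subset_of_primeIdeal_le hS (hTQ.trans hQS)).eq_or_ssubset with h | h
    · rw [h]
      exact hTQ
    · exact absurd (hTQ.trans hQS) (hmax _ hT h).2
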